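/- **Setting.** Let $n\ge 2$ and let $\Omega\subset\mathbb R^n$ be a bounded domain with smooth boundary. Let $\Gamma\subset\mathbb R^n$ be an open convex symmetric cone with vertex at the origin containing the positive cone $\{\lambda:\lambda_i>0,\ 1\le i\le n\}$, and let $f\in C^2(\Gamma)\cap C(\overline\Gamma)$ be a symmetric function such that $\partial f/\partial\lambda_i>0$ in $\Gamma$ for every $i$, $f$ is concave in $\Gamma$, $f>0$ in $\Gamma$ and $f=0$ on $\partial\Gamma$. Let $\psi\in C^\infty(\overline\Omega)$ with $\psi\ge 0$ in $\Omega$, let $\varphi\in C^\infty(\partial\Omega)$, let $\varepsilon_0>0$ be such that $\varepsilon_0\le f(\mu)$ for some $\mu\in\Gamma$, and let $\eta\in C^\infty[0,\infty)$ satisfy $0\le\eta\le1$, $\eta=1$ on $[0,\varepsilon_0/4]$ and $\eta=0$ on $[\varepsilon_0/2,\infty)$. For $\gamma>0$ and $0<\varepsilon\le\varepsilon_0/2$ consider the Dirichlet problem $$f\big(\lambda[D^2u+\gamma\Delta u\,I]\big)=\psi+\varepsilon\,\eta(\psi)\ \text{ in }\Omega,\qquad u=\varphi\ \text{ on }\partial\Omega,\tag{$*$}$$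 where $\lambda[A]$ denotes the eigenvalues of the symmetric matrix $A$. A solution $u$ is called admissible if $\lambda[D^2u+\gamma\Delta u\,I]\in\overline\Gamma$ in $\Omega$. **Theorem.** For all real $K$ and $M$ there is a constant $C>0$, depending only on $K$, $M$ and the data $n,\Omega,\Gamma,f,\psi,\varphi,\varepsilon_0,\eta$, such that for every $\gamma>0$ with $\gamma^{-1}\le K$, every $\varepsilon\in(0,\varepsilon_0/2]$ and every admissible solution $u\in C^4(\overline\Omega)$ of $(*)$ with $|u|_{C^1(\overline\Omega)}=\sup_\Omega|u|+\sup_\Omega|Du|\le M$, $$\sup_{\overline\Omega}|D^2u|\le C\Big(1+\sup_{\partial\Omega}|D^2u|\Big).$$ In particular $C$ does not depend on $\varepsilon$. Here $|D^2u|=(\sum_{i,j}u_{ij}^2)^{1/2}$, and on $\partial\Omega$ the Hessian is the continuous extension of $D^2u$ from $\Omega$. -/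

import Mathlib

open Set Filter Topology
open scoped ContDiff

noncomputable section

namespace HessianDirichlet

/-- The Euclidean space `ℝⁿ`. -/
abbrev E (n : ℕ) : Type := EuclideanSpace ℝ (Fin n)

/-! ### Domains and function spaces -/

/-- `∂Ω` is smooth: near each boundary point, `Ω` is the sublevel set of a smooth function
whose differential does not vanish at that point. -/
def HasSmoothBoundary {n : ℕ} (Ω : Set (E n)) : Prop :=
  ∀ x ∈ frontier Ω, ∃ (V : Set (E n)) (ρ : E n → ℝ), IsOpen V ∧ x ∈ V ∧
    ContDiff ℝ ∞ ρ ∧ fderiv ℝ ρ x ≠ 0 ∧ ∀ y ∈ V, y ∈ Ω ↔ ρ y < 0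

/-- A bounded domain (nonempty, open, connected) with smooth boundary. -/
structure IsSmoothBoundedDomain {n : ℕ} (Ω : Set (E n)) : Prop where
  isOpen : IsOpen Ω
  isConnected : IsConnected Ω
  isBounded : Bornology.IsBounded Ω
  smooth_boundary : HasSmoothBoundary Ω

/-- `u ∈ Cᵏ(Ω̄)`: `u` is continuous on `Ω̄`, of class `Cᵏ` in the open set `Ω`, and all its
derivatives of order at most `k` in `Ω` have continuous extensions to `Ω̄`. -/
def ContDiffUpToBoundary {n : ℕ} (k : ℕ∞) (u : E n → ℝ) (Ω : Set (E n)) : Prop :=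
  ContinuousOn u (closure Ω) ∧ ContDiffOn ℝ k u Ω ∧
    ∀ m : ℕ, (m : ℕ∞) ≤ k → ∃ g : E n → (E n) [×m]→L[ℝ] ℝ,
      ContinuousOn g (closure Ω) ∧ EqOn (iteratedFDeriv ℝ m u) g Ω

/-- `φ ∈ C^∞(∂Ω)`: `φ` is on `∂Ω` the restriction of a smooth function on `ℝⁿ`. -/
def SmoothOnBoundary {n : ℕ} (φ : E n → ℝ) (Ω : Set (E n)) : Prop :=
  ∃ Φ : E n → ℝ, ContDiff ℝ ∞ Φ ∧ EqOn φ Φ (frontier Ω)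

/-- `|u|_{C¹(Ω̄)} = sup |u| + sup |Du|`. The suprema are taken over `Ω`; for `u ∈ C¹(Ω̄)` they are
finite and equal to the suprema over `Ω̄`. -/
def c1Norm {n : ℕ} (u : E n → ℝ) (Ω : Set (E n)) : ℝ :=
  sSup ((fun x => |u x|) '' Ω) + sSup ((fun x => ‖fderiv ℝ u x‖) '' Ω)

/-! ### The Hessian and its eigenvalues -/

/-- The Hessian matrix `D²u(x)` of second partial derivatives, at interior points. -/
def hess {n : ℕ} (u : E n → ℝ) (x : E n) : Matrix (Fin n) (Fin n) ℝ :=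
  Matrix.of fun i j => iteratedFDeriv ℝ 2 u x
    ![EuclideanSpace.single i (1 : ℝ), EuclideanSpace.single j (1 : ℝ)]

/-- The Hessian `D²u` on `Ω̄`: the extension by continuity of `D²u` from `Ω`. For
`u ∈ C²(Ω̄)` it coincides with `hess u` in `Ω` and is continuous on `Ω̄`. -/
def hessExt {n : ℕ} (u : E n → ℝ) (Ω : Set (E n)) : E n → Matrix (Fin n) (Fin n) ℝ :=
  extendFrom Ω (hess u)

/-- The Euclidean norm `|A| = (∑ aᵢⱼ²)^{1/2}` of a matrix. -/
def matNorm {n : ℕ} (A : Matrix (Fin n) (Fin n) ℝ) : ℝ :=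
  Real.sqrt (∑ i, ∑ j, A i j ^ 2)

/-- `λ[A]`, the eigenvalues of a symmetric matrix `A` repeated according to multiplicity
(the value for a matrix that is not symmetric is irrelevant). -/
def eig {n : ℕ} (A : Matrix (Fin n) (Fin n) ℝ) : Fin n → ℝ :=
  open Classical in if h : A.IsHermitian then h.eigenvalues else 0

/-- The matrix `D²u(x) + γ Δu(x) I`; the Laplacian is the trace of the Hessian. -/
def hessGamma {n : ℕ} (γ : ℝ) (u : E n → ℝ) (x : E n) : Matrix (Fin n) (Fin n) ℝ :=
  hess u x + (γ * (hess u x).trace) • (1 : Matrix (Fin n) (Fin n) ℝ)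

/-! ### The structure conditions -/

/-- `Γ` is an open convex symmetric cone with vertex at the origin that contains the positive
cone `Γₙ`. -/
structure IsAdmissibleCone {n : ℕ} (Γ : Set (Fin n → ℝ)) : Prop where
  isOpen : IsOpen Γ
  convex : Convex ℝ Γ
  symm : ∀ (σ : Equiv.Perm (Fin n)), ∀ x ∈ Γ, x ∘ σ ∈ Γ
  cone : ∀ t : ℝ, 0 < t → ∀ x ∈ Γ, t • x ∈ Γ
  positive_cone : {x : Fin n → ℝ | ∀ i, 0 < x i} ⊆ Γ

/-- The conditions on `f`: it is a symmetric function in `C²(Γ) ∩ C(Γ̄)` with `∂f/∂λᵢ > 0`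
in `Γ`, it is concave and positive in `Γ`, and it vanishes on `∂Γ`. -/
structure StructureConditions {n : ℕ} (Γ : Set (Fin n → ℝ)) (f : (Fin n → ℝ) → ℝ) : Prop where
  contDiffOn : ContDiffOn ℝ 2 f Γ
  continuousOn : ContinuousOn f (closure Γ)
  symm : ∀ (σ : Equiv.Perm (Fin n)), ∀ x ∈ Γ, f (x ∘ σ) = f x
  deriv_pos : ∀ x ∈ Γ, ∀ i, 0 < fderiv ℝ f x (Pi.single i 1)
  concave : ConcaveOn ℝ Γ f
  pos : ∀ x ∈ Γ, 0 < f x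
  boundary : ∀ x ∈ frontier Γ, f x = 0

/-! ### The approximating problem -/

/-- The cutoff function `η ∈ C^∞[0, ∞)` with `0 ≤ η ≤ 1`, `η = 1` on `[0, ε₀/4]` and `η = 0` on
`[ε₀/2, ∞)`. -/
structure IsCutoff (ε₀ : ℝ) (η : ℝ → ℝ) : Prop where
  smooth : ContDiffOn ℝ ∞ η (Ici 0)
  eq_one : ∀ t ∈ Icc 0 (ε₀ / 4), η t = 1
  eq_zero : ∀ t ∈ Ici (ε₀ / 2), η t = 0
  mem_Icc : ∀ t ∈ Ici (0 : ℝ), η t ∈ Icc (0 : ℝ) 1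

/-- `u` is admissible: `λ[D²u + γ Δu I] ∈ Γ̄` in `Ω`. -/
def IsAdmissible {n : ℕ} (Γ : Set (Fin n → ℝ)) (γ : ℝ) (Ω : Set (E n)) (u : E n → ℝ) : Prop :=
  ∀ x ∈ Ω, eig (hessGamma γ u x) ∈ closure Γ

/-- `u ∈ C⁴(Ω̄)` is an admissible solution of the approximating Dirichlet problem
`f(λ[D²u + γ Δu I]) = ψ + ε η(ψ)` in `Ω`, `u = φ` on `∂Ω`. -/
structure IsApproxSolution {n : ℕ} (Ω : Set (E n)) (Γ : Set (Fin n → ℝ)) (f : (Fin n → ℝ) → ℝ)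
    (ψ φ : E n → ℝ) (η : ℝ → ℝ) (γ ε : ℝ) (u : E n → ℝ) : Prop where
  regular : ContDiffUpToBoundary 4 u Ω
  admissible : IsAdmissible Γ γ Ω u
  equation : ∀ x ∈ Ω, f (eig (hessGamma γ u x)) = ψ x + ε * η (ψ x)
  boundary : ∀ x ∈ frontier Ω, u x = φ x

end HessianDirichlet

end

noncomputable section

namespace HessianDirichlet

open Matrix

/-! This is the classical argument of differentiating the equation twice and using concavity. Write
`Ψ = ψ + ε η(ψ)`. Since `Ψ > 0`, the eigenvalues lie in the open cone (`mem_of_pos`), where `f` is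
differentiable. By Birkhoff's theorem, symmetry and concavity of `f` pass to the matrix function `f
∘ λ`: its linearization at `A`, taken in an eigenbasis of `A`, is a supergradient
(`eig_le_tangent`). Hence the linearized operator applied to `u_ee` is at least `Ψ_ee ≥ -N`, with
`N` independent of `ε` (`exists_rhs_bound`).

Applied to `A|x|²/2` with `A ≥ 0`, the same operator gives at least `A ∑ ∂f/∂λᵢ`. This sum is at
least some `c > 0`: by concavity and `∑ λᵢ ∂f/∂λᵢ ≥ 0` it controls the gap between `f(λ)` and
`f(b,…,b)` (`le_mul_sum_deriv`), and the right-hand sides stay uniformly below `f(b,…,b)` for a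
suitable `b` (`exists_gap`). For `A c > N` the function `u_ee + A|x|²/2` therefore has no interior
maximum (`not_isLocalMax_secondDeriv`), which bounds `u_ee` above by boundary values.

Finally `Γ` lies in the half-space of positive sum, so `Δu > 0`, and upper bounds on all `u_ee`
bound the whole Hessian (`matNorm_le`). -/

/-! ### Concave functions -/

/-- A concave function lies below its tangent planes. -/
theorem concaveOn_le_add_fderiv {F : Type*} [NormedAddCommGroup F] [NormedSpace ℝ F] {s : Set F}
    {f : F → ℝ} (hf : ConcaveOn ℝ s f) {x y : F} (hx : x ∈ s) (hy : y ∈ s)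
    (hd : DifferentiableAt ℝ f x) : f y ≤ f x + fderiv ℝ f x (y - x) := by
  have hmem : ∀ t ∈ Icc (0 : ℝ) 1, AffineMap.lineMap (k := ℝ) x y t ∈ s := fun t ht =>
    hf.1.lineMap_mem hx hy ht
  have hc : ConcaveOn ℝ (Icc (0 : ℝ) 1) (f ∘ AffineMap.lineMap (k := ℝ) x y) :=
    (hf.comp_affineMap (AffineMap.lineMap (k := ℝ) x y)).subset hmem (convex_Icc 0 1)
  have hd0 : DifferentiableAt ℝ f (AffineMap.lineMap (k := ℝ) x y 0) := by simpa using hd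
  have hder : HasDerivAt (f ∘ AffineMap.lineMap (k := ℝ) x y) (fderiv ℝ f x (y - x)) 0 := by
    have := hd0.hasFDerivAt.comp_hasDerivAt (0 : ℝ)
      (AffineMap.hasDerivAt_lineMap (𝕜 := ℝ) (a := x) (b := y))
    simpa using this
  have := hc.slope_le_of_hasDerivAt (by simp) (by simp) zero_lt_one hder
  simp only [slope_def_field, Function.comp_apply, AffineMap.lineMap_apply_one,
    AffineMap.lineMap_apply_zero, sub_zero, div_one] at this
  linarith

theorem apply_eq_sum_single {n : ℕ} (L : (Fin n → ℝ) →L[ℝ] ℝ) (v : Fin n → ℝ) :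
    L v = ∑ i, v i * L (Pi.single i 1) := by
  conv_lhs => rw [pi_eq_sum_univ' v]
  simp [map_sum]

/-! ### Structure of the cone -/

section Cone

variable {n : ℕ} {Γ : Set (Fin n → ℝ)} {f : (Fin n → ℝ) → ℝ}

theorem IsAdmissibleCone.add_mem (hΓ : IsAdmissibleCone Γ) {x y : Fin n → ℝ} (hx : x ∈ Γ)
    (hy : y ∈ Γ) : x + y ∈ Γ := by
  have h := hΓ.cone 2 two_pos _ (hΓ.convex hx hy (a := 1 / 2) (b := 1 / 2) (by norm_num)
    (by norm_num) (by norm_num))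
  convert h using 1
  ext i
  simp
  ring

theorem IsAdmissibleCone.const_mem (hΓ : IsAdmissibleCone Γ) {a : ℝ} (ha : 0 < a) :
    (fun _ => a) ∈ Γ := hΓ.positive_cone fun _ => ha

/-- By openness `x` can be lowered slightly along the diagonal inside `Γ`; the difference to `y`
then has strictly positive entries. -/
theorem IsAdmissibleCone.mem_of_le (hΓ : IsAdmissibleCone Γ) {x y : Fin n → ℝ} (hx : x ∈ Γ)
    (hxy : x ≤ y) : y ∈ Γ := by
  have hc : ContinuousAt (fun t : ℝ => x - fun _ => t) 0 := by fun_prop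
  have hev : ∀ᶠ t in 𝓝[>] (0 : ℝ), (x - fun _ => t) ∈ Γ :=
    (hc.eventually_mem (hΓ.isOpen.mem_nhds (by convert hx using 1; ext; simp))).filter_mono
      nhdsWithin_le_nhds
  obtain ⟨t, ht, ht0⟩ := (hev.and self_mem_nhdsWithin).exists
  have h : (fun i => y i - x i + t) ∈ Γ := hΓ.positive_cone fun i => by
    have := hxy i
    have : (0 : ℝ) < t := ht0
    linarith
  convert hΓ.add_mem ht h using 1
  ext i
  simp

theorem StructureConditions.differentiableAt (hΓ : IsAdmissibleCone Γ)
    (hf : StructureConditions Γ f) {x : Fin n → ℝ} (hx : x ∈ Γ) : DifferentiableAt ℝ f x :=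
  (hf.contDiffOn.contDiffAt (hΓ.isOpen.mem_nhds hx)).differentiableAt (by norm_num)

theorem StructureConditions.le_tangent (hΓ : IsAdmissibleCone Γ) (hf : StructureConditions Γ f)
    {x y : Fin n → ℝ} (hx : x ∈ Γ) (hy : y ∈ Γ) : f y ≤ f x + fderiv ℝ f x (y - x) :=
  concaveOn_le_add_fderiv hf.concave hx hy (hf.differentiableAt hΓ hx)

theorem StructureConditions.fderiv_nonneg (hf : StructureConditions Γ f)
    {x v : Fin n → ℝ} (hx : x ∈ Γ) (hv : 0 ≤ v) : 0 ≤ fderiv ℝ f x v := by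
  rw [apply_eq_sum_single]
  exact Finset.sum_nonneg fun i _ => mul_nonneg (hv i) (hf.deriv_pos x hx i).le

theorem StructureConditions.mono (hΓ : IsAdmissibleCone Γ) (hf : StructureConditions Γ f)
    {x y : Fin n → ℝ} (hx : x ∈ Γ) (hxy : x ≤ y) : f x ≤ f y := by
  have hy := hΓ.mem_of_le hx hxy
  have h1 := hf.le_tangent hΓ hy hx
  have h2 := hf.fderiv_nonneg hy (sub_nonneg.2 hxy)
  have h3 : fderiv ℝ f y (x - y) = - fderiv ℝ f y (y - x) := by rw [← map_neg, neg_sub]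
  linarith

theorem StructureConditions.const_lt_const (hΓ : IsAdmissibleCone Γ)
    (hf : StructureConditions Γ f) (hn : 0 < n) {a b : ℝ} (ha : 0 < a) (hab : a < b) :
    f (fun _ => a) < f (fun _ => b) := by
  have hb : 0 < b := ha.trans hab
  have h1 := hf.le_tangent hΓ (hΓ.const_mem hb) (hΓ.const_mem ha)
  rw [apply_eq_sum_single] at h1
  have h2 : ∑ i, ((fun _ => a) - (fun _ => b) : Fin n → ℝ) i *
      fderiv ℝ f (fun _ => b) (Pi.single i 1) < 0 := by
    have : Nonempty (Fin n) := ⟨⟨0, hn⟩⟩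
    refine Finset.sum_neg (fun i _ => ?_) Finset.univ_nonempty
    have := hf.deriv_pos _ (hΓ.const_mem hb) i
    simp only [Pi.sub_apply]
    exact mul_neg_of_neg_of_pos (by linarith) this
  linarith

/-- Positivity and concavity along rays give `∑ λᵢ ∂f/∂λᵢ ≥ 0`. -/
theorem StructureConditions.fderiv_self_nonneg (hΓ : IsAdmissibleCone Γ)
    (hf : StructureConditions Γ f) {x : Fin n → ℝ} (hx : x ∈ Γ) : 0 ≤ fderiv ℝ f x x := by
  by_contra! h
  set D := fderiv ℝ f x x with hD
  -- If the slope `D` along the ray were negative, the tangent at `x` would reach zero at the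
  -- multiple `1 + f x / (-D)` of `x`, contradicting positivity of `f` there.
  have hs : 0 < 1 + f x / (-D) := by
    have := div_pos (hf.pos x hx) (neg_pos.2 h)
    linarith
  have h1 := hf.le_tangent hΓ hx (hΓ.cone _ hs x hx)
  have h2 := hf.pos _ (hΓ.cone _ hs x hx)
  have h3 : (1 + f x / (-D)) • x - x = (f x / (-D)) • x := by rw [add_smul, one_smul]; abel
  rw [h3, map_smul, ← hD, smul_eq_mul] at h1
  have h4 : f x / (-D) * D = - f x := by
    rw [div_neg, neg_mul, div_mul_cancel₀ _ h.ne]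
  linarith

/-- The trace of the linearization at `x` is controlled from below by the gap between `f x` and
a larger value of `f`. -/
theorem StructureConditions.le_mul_sum_deriv (hΓ : IsAdmissibleCone Γ)
    (hf : StructureConditions Γ f) {x : Fin n → ℝ} (hx : x ∈ Γ) {b : ℝ} (hb : 0 < b) :
    f (fun _ => b) - f x ≤ b * ∑ i, fderiv ℝ f x (Pi.single i 1) := by
  have h1 := hf.le_tangent hΓ hx (hΓ.const_mem hb)
  have h2 := hf.fderiv_self_nonneg hΓ hx
  rw [map_sub, apply_eq_sum_single _ (fun _ => b), ← Finset.mul_sum] at h1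
  linarith

/-- Otherwise `Γ` would contain the whole diagonal line, on which a concave function with positive
slope at `0` cannot remain positive. -/
theorem StructureConditions.zero_notMem (hΓ : IsAdmissibleCone Γ)
    (hf : StructureConditions Γ f) (hn : 0 < n) : (0 : Fin n → ℝ) ∉ Γ := by
  intro h0
  have hline : ∀ t : ℝ, (fun _ => t : Fin n → ℝ) ∈ Γ := by
    have hc : ContinuousAt (fun t : ℝ => (fun _ => -t : Fin n → ℝ)) 0 := by fun_prop
    have hev : ∀ᶠ t in 𝓝[>] (0 : ℝ), (fun _ => -t : Fin n → ℝ) ∈ Γ :=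
      (hc.eventually_mem (hΓ.isOpen.mem_nhds (by convert h0 using 1; ext; simp))).filter_mono
        nhdsWithin_le_nhds
    obtain ⟨s, hs, hs0⟩ := (hev.and self_mem_nhdsWithin).exists
    have hs0 : 0 < s := hs0
    intro t
    -- Dilating `(-s,…,-s)` gives `(-(|t|+1),…)`, which lies below `(t,…,t)`.
    have h1 := hΓ.cone ((|t| + 1) / s) (by positivity) _ hs
    refine hΓ.mem_of_le h1 fun i => ?_
    simp only [Pi.smul_apply, smul_eq_mul]
    rw [mul_neg, div_mul_cancel₀ _ hs0.ne']
    linarith [neg_abs_le t]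
  set T := ∑ i, fderiv ℝ f (0 : Fin n → ℝ) (Pi.single i 1) with hT
  have hTpos : 0 < T := by
    have : Nonempty (Fin n) := ⟨⟨0, hn⟩⟩
    exact Finset.sum_pos (fun i _ => hf.deriv_pos _ h0 i) Finset.univ_nonempty
  -- The tangent plane at `0` vanishes at this diagonal point.
  have h1 := hf.le_tangent hΓ h0 (hline (-(f 0 / T)))
  have h2 := hf.pos _ (hline (-(f 0 / T)))
  rw [sub_zero, apply_eq_sum_single _ (fun _ => -(f 0 / T)), ← Finset.mul_sum, ← hT] at h1
  have h4 : -(f 0 / T) * T = - f 0 := by field_simp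
  linarith

/-- The permutation average of a vector in `Γ` lies in `Γ`; so `Γ ⊆ {∑ λᵢ > 0}`. -/
theorem StructureConditions.sum_pos (hΓ : IsAdmissibleCone Γ)
    (hf : StructureConditions Γ f) (hn : 0 < n) {x : Fin n → ℝ} (hx : x ∈ Γ) :
    0 < ∑ i, x i := by
  by_contra! hle
  have : NeZero n := ⟨hn.ne'⟩
  -- The `n` cyclic shifts suffice: over all of them `x` adds up to the constant vector with entries
  -- `∑ x i`. Were this sum `≤ 0`, upward closedness would put `0` in `Γ`.
  have hsum : ∀ s : Finset (Fin n), s.Nonempty → ∑ k ∈ s, x ∘ (Equiv.addRight k) ∈ Γ := by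
    intro s hs
    induction hs using Finset.Nonempty.cons_induction with
    | singleton a => simpa only [Finset.sum_singleton] using hΓ.symm (Equiv.addRight a) x hx
    | cons a s ha hs ih =>
      rw [Finset.sum_cons]
      exact hΓ.add_mem (hΓ.symm _ x hx) ih
  have h := hsum Finset.univ Finset.univ_nonempty
  refine hf.zero_notMem hΓ hn (hΓ.mem_of_le h fun i => ?_)
  rw [Finset.sum_apply]
  simp only [Function.comp_apply, Equiv.coe_addRight, Pi.zero_apply]
  exact (Equiv.sum_comp (Equiv.addLeft i) x).trans_le hle

/-- Upgrades admissibility from the closed to the open cone, where `f` is differentiable. -/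
theorem StructureConditions.mem_of_pos (hΓ : IsAdmissibleCone Γ)
    (hf : StructureConditions Γ f) {x : Fin n → ℝ} (hx : x ∈ closure Γ) (hpos : 0 < f x) :
    x ∈ Γ := by
  by_contra h
  refine hpos.ne' (hf.boundary x ⟨hx, ?_⟩)
  rwa [hΓ.isOpen.interior_eq]

/-- Averaging by a doubly stochastic matrix increases `f`. -/
theorem StructureConditions.le_doublyStochastic (hf : StructureConditions Γ f)
    {S : Matrix (Fin n) (Fin n) ℝ} (hS : S ∈ doublyStochastic ℝ (Fin n))
    (hΓ : IsAdmissibleCone Γ) {x : Fin n → ℝ} (hx : x ∈ Γ) : S *ᵥ x ∈ Γ ∧ f x ≤ f (S *ᵥ x) := by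
  -- The superlevel set of `f` at `f x` is convex and contains every permutation of `x`; by Birkhoff
  -- it contains `S *ᵥ x`.
  have hconv : Convex ℝ ((fun S : Matrix (Fin n) (Fin n) ℝ => S *ᵥ x) ⁻¹' {y ∈ Γ | f x ≤ f y}) :=
    (hf.concave.convex_ge (f x)).is_linear_preimage
      ⟨fun A B => Matrix.add_mulVec A B x, fun c A => Matrix.smul_mulVec c A x⟩
  have hS' : S ∈ convexHull ℝ {σ.permMatrix ℝ | σ : Equiv.Perm (Fin n)} := by
    rw [← doublyStochastic_eq_convexHull_permMatrix]
    exact hS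
  refine convexHull_min ?_ hconv hS'
  rintro _ ⟨σ, rfl⟩
  simp only [mem_preimage, mem_ofPred_eq, permMatrix_mulVec]
  exact ⟨hΓ.symm σ x hx, (hf.symm σ x hx).ge⟩

end Cone

/-! ### Eigenvalues -/

section Eig

variable {n : ℕ}

/-- The quadratic form of a matrix. -/
def quadForm (A : Matrix (Fin n) (Fin n) ℝ) (v : E n) : ℝ := v.ofLp ⬝ᵥ A *ᵥ v.ofLp

theorem quadForm_eq_sum (A : Matrix (Fin n) (Fin n) ℝ) (v : E n) :
    quadForm A v = ∑ i, ∑ j, v i * v j * A i j := by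
  simp only [quadForm, dotProduct, Matrix.mulVec, Finset.mul_sum]
  exact Finset.sum_congr rfl fun i _ => Finset.sum_congr rfl fun j _ => by ring

theorem quadForm_eq_sum_eigenvalues {A : Matrix (Fin n) (Fin n) ℝ} (hA : A.IsHermitian)
    (v : E n) : quadForm A v = ∑ j, inner ℝ v (hA.eigenvectorBasis j) ^ 2 * hA.eigenvalues j := by
  have h1 := hA.eigenvectorBasis.sum_inner_mul_inner v (WithLp.toLp 2 (A *ᵥ v.ofLp))
  have h2 : inner ℝ v (WithLp.toLp 2 (A *ᵥ v.ofLp)) = quadForm A v := by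
    rw [EuclideanSpace.inner_eq_star_dotProduct, quadForm, dotProduct_comm]
    simp
  rw [← h2, ← h1]
  refine Finset.sum_congr rfl fun j _ => ?_
  have h3 : inner ℝ (hA.eigenvectorBasis j) (WithLp.toLp 2 (A *ᵥ v.ofLp)) =
      hA.eigenvalues j * inner ℝ v (hA.eigenvectorBasis j) := by
    rw [EuclideanSpace.inner_eq_star_dotProduct, EuclideanSpace.inner_eq_star_dotProduct]
    simp only [star_trivial]
    have hT : Aᵀ = A := (conjTranspose_eq_transpose_of_trivial A).symm.trans hA
    rw [dotProduct_comm, Matrix.dotProduct_mulVec, ← Matrix.mulVec_transpose, hT,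
      hA.mulVec_eigenvectorBasis, smul_dotProduct, smul_eq_mul]
  rw [h3]
  ring

theorem eig_eq {A : Matrix (Fin n) (Fin n) ℝ} (hA : A.IsHermitian) : eig A = hA.eigenvalues := by
  rw [eig, dif_pos hA]

theorem sum_eig {A : Matrix (Fin n) (Fin n) ℝ} (hA : A.IsHermitian) : ∑ i, eig A i = A.trace := by
  rw [eig_eq hA, hA.trace_eq_sum_eigenvalues]
  simp

theorem eig_eq_quadForm {A : Matrix (Fin n) (Fin n) ℝ} (hA : A.IsHermitian) (i : Fin n) :
    eig A i = quadForm A (hA.eigenvectorBasis i) := by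
  rw [eig_eq hA, hA.eigenvalues_eq]
  simp [quadForm]

/-- The diagonal of a symmetric matrix in an orthonormal basis is obtained from its eigenvalues by
a doubly stochastic matrix. -/
theorem exists_doublyStochastic {A : Matrix (Fin n) (Fin n) ℝ} (hA : A.IsHermitian)
    (b : OrthonormalBasis (Fin n) ℝ (E n)) :
    ∃ S ∈ doublyStochastic ℝ (Fin n), (fun i => quadForm A (b i)) = S *ᵥ eig A := by
  refine ⟨Matrix.of fun i j => inner ℝ (b i) (hA.eigenvectorBasis j) ^ 2, ?_, ?_⟩
  · rw [mem_doublyStochastic_iff_sum]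
    refine ⟨fun i j => sq_nonneg _, fun i => ?_, fun j => ?_⟩
    · have := hA.eigenvectorBasis.sum_inner_mul_inner (b i) (b i)
      simp only [Matrix.of_apply]
      rw [real_inner_self_eq_norm_sq, b.norm_eq_one, one_pow] at this
      rw [← this]
      exact Finset.sum_congr rfl fun j _ => by rw [real_inner_comm (b i), sq]
    · have := b.sum_inner_mul_inner (hA.eigenvectorBasis j) (hA.eigenvectorBasis j)
      simp only [Matrix.of_apply]
      rw [real_inner_self_eq_norm_sq, OrthonormalBasis.norm_eq_one, one_pow] at this
      rw [← this]
      exact Finset.sum_congr rfl fun i _ => by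
        rw [real_inner_comm (b i) (hA.eigenvectorBasis j), sq]
  · ext i
    rw [quadForm_eq_sum_eigenvalues hA, eig_eq hA]
    rfl

/-- The linearization of `f ∘ λ` at a symmetric matrix `A`, computed in an eigenbasis of `A`, is a
supergradient. -/
theorem StructureConditions.eig_le_tangent {Γ : Set (Fin n → ℝ)} {f : (Fin n → ℝ) → ℝ}
    (hΓ : IsAdmissibleCone Γ) (hf : StructureConditions Γ f) {A B : Matrix (Fin n) (Fin n) ℝ}
    (hA : A.IsHermitian) (hB : B.IsHermitian) (hAΓ : eig A ∈ Γ) (hBΓ : eig B ∈ Γ) :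
    f (eig B) ≤ f (eig A) + ∑ i, (quadForm B (hA.eigenvectorBasis i) -
      quadForm A (hA.eigenvectorBasis i)) * fderiv ℝ f (eig A) (Pi.single i 1) := by
  -- The diagonal of `B` in the eigenbasis of `A` has a larger value of `f` than `eig B`, and the
  -- tangent inequality at `eig A` applies to it.
  obtain ⟨S, hS, hd⟩ := exists_doublyStochastic hB hA.eigenvectorBasis
  obtain ⟨h1, h2⟩ := hf.le_doublyStochastic hS hΓ hBΓ
  have h3 := hf.le_tangent hΓ hAΓ h1
  rw [apply_eq_sum_single, ← hd] at h3
  rw [← hd] at h2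
  refine h2.trans (h3.trans_eq ?_)
  simp [eig_eq_quadForm hA]

end Eig

/-! ### Directional derivatives -/

section DirDeriv

variable {n : ℕ} {Ω : Set (E n)}

/-- The derivative of `u` in the direction `v`. -/
def dirDeriv (v : E n) (u : E n → ℝ) : E n → ℝ := fun x => fderiv ℝ u x v

theorem contDiffOn_dirDeriv (hΩ : IsOpen Ω) {k l : ℕ∞ω} {u : E n → ℝ} (hu : ContDiffOn ℝ l u Ω)
    (hkl : k + 1 ≤ l) (v : E n) : ContDiffOn ℝ k (dirDeriv v u) Ω :=
  (hu.fderiv_of_isOpen hΩ hkl).clm_apply contDiffOn_const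

theorem contDiffOn_dirDeriv_dirDeriv (hΩ : IsOpen Ω) {u : E n → ℝ} (hu : ContDiffOn ℝ 4 u Ω)
    (v w : E n) : ContDiffOn ℝ 2 (dirDeriv v (dirDeriv w u)) Ω :=
  contDiffOn_dirDeriv hΩ (contDiffOn_dirDeriv hΩ (k := 3) hu (by norm_num) w) (by norm_num) v

theorem dirDeriv_congr (hΩ : IsOpen Ω) {u w : E n → ℝ} (h : EqOn u w Ω) (v : E n) :
    EqOn (dirDeriv v u) (dirDeriv v w) Ω := fun x hx => by
  have : u =ᶠ[𝓝 x] w := h.eventuallyEq_of_mem (hΩ.mem_nhds hx)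
  simp only [dirDeriv, this.fderiv_eq]

theorem dirDeriv_dirDeriv_eq {u : E n → ℝ} {x : E n} (hu : ContDiffAt ℝ 2 u x) (v w : E n) :
    dirDeriv v (dirDeriv w u) x = fderiv ℝ (fderiv ℝ u) x v w := by
  have hd : DifferentiableAt ℝ (fderiv ℝ u) x :=
    (hu.fderiv_right (m := 1) (by norm_num)).differentiableAt (by norm_num)
  change fderiv ℝ (fun y => fderiv ℝ u y w) x v = _
  rw [fderiv_clm_apply hd (by fun_prop)]
  simp

theorem dirDeriv_comm (hΩ : IsOpen Ω) {u : E n → ℝ} (hu : ContDiffOn ℝ 2 u Ω) (v w : E n) :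
    EqOn (dirDeriv v (dirDeriv w u)) (dirDeriv w (dirDeriv v u)) Ω := fun x hx => by
  have hc := hu.contDiffAt (hΩ.mem_nhds hx)
  rw [dirDeriv_dirDeriv_eq hc, dirDeriv_dirDeriv_eq hc]
  exact hc.isSymmSndFDerivAt (by simp) v w

/-- Second directional derivatives of a `C⁴` function commute. -/
theorem dirDeriv_sq_comm (hΩ : IsOpen Ω) {u : E n → ℝ} (hu : ContDiffOn ℝ 4 u Ω) (v w : E n) :
    EqOn (dirDeriv v (dirDeriv v (dirDeriv w (dirDeriv w u))))
      (dirDeriv w (dirDeriv w (dirDeriv v (dirDeriv v u)))) Ω := by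
  have h2 : ContDiffOn ℝ 2 u Ω := hu.of_le (by norm_num)
  have h3 : ∀ z, ContDiffOn ℝ 3 (dirDeriv z u) Ω := fun z =>
    contDiffOn_dirDeriv hΩ hu (by norm_num) z
  have h3' : ∀ z, ContDiffOn ℝ 2 (dirDeriv z u) Ω := fun z => (h3 z).of_le (by norm_num)
  have h4 : ∀ y z, ContDiffOn ℝ 2 (dirDeriv y (dirDeriv z u)) Ω := fun y z =>
    contDiffOn_dirDeriv_dirDeriv hΩ hu y z
  -- Adjacent exchanges: `vvww → vwvw → vwwv → wvwv → wwvv`.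
  have e1 := dirDeriv_congr hΩ (dirDeriv_comm hΩ (h3' w) v w) v
  have e2 := dirDeriv_congr hΩ (dirDeriv_congr hΩ (dirDeriv_comm hΩ h2 v w) w) v
  have e3 := dirDeriv_comm hΩ (h4 w v) v w
  have e4 := dirDeriv_congr hΩ (dirDeriv_comm hΩ (h3' v) v w) w
  exact e1.trans (e2.trans (e3.trans e4))

theorem dirDeriv_add {u w : E n → ℝ} {x : E n} (hu : DifferentiableAt ℝ u x)
    (hw : DifferentiableAt ℝ w x) (v : E n) :
    dirDeriv v (fun y => u y + w y) x = dirDeriv v u x + dirDeriv v w x := by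
  simp only [dirDeriv]
  rw [fderiv_fun_add hu hw]
  rfl

theorem dirDeriv_const_mul {u : E n → ℝ} {x : E n} (hu : DifferentiableAt ℝ u x) (c : ℝ)
    (v : E n) : dirDeriv v (fun y => c * u y) x = c * dirDeriv v u x := by
  simp only [dirDeriv]
  rw [fderiv_const_mul hu]
  rfl

theorem dirDeriv_sum {ι : Type*} {s : Finset ι} {u : ι → E n → ℝ} {x : E n}
    (hu : ∀ i ∈ s, DifferentiableAt ℝ (u i) x) (v : E n) :
    dirDeriv v (fun y => ∑ i ∈ s, u i y) x = ∑ i ∈ s, dirDeriv v (u i) x := by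
  simp only [dirDeriv]
  rw [fderiv_fun_sum hu]
  simp

theorem differentiableAt_of_contDiffOn (hΩ : IsOpen Ω) {u : E n → ℝ} (hu : ContDiffOn ℝ 1 u Ω)
    {x : E n} (hx : x ∈ Ω) : DifferentiableAt ℝ u x :=
  (hu.contDiffAt (hΩ.mem_nhds hx)).differentiableAt (by norm_num)

theorem differentiableAt_dirDeriv (hΩ : IsOpen Ω) {u : E n → ℝ} (hu : ContDiffOn ℝ 2 u Ω)
    {x : E n} (hx : x ∈ Ω) (v : E n) : DifferentiableAt ℝ (dirDeriv v u) x :=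
  differentiableAt_of_contDiffOn hΩ (contDiffOn_dirDeriv hΩ hu (by norm_num) v) hx

theorem dirDeriv_sq_add (hΩ : IsOpen Ω) {u w : E n → ℝ} (hu : ContDiffOn ℝ 2 u Ω)
    (hw : ContDiffOn ℝ 2 w Ω) (v : E n) {x : E n} (hx : x ∈ Ω) :
    dirDeriv v (dirDeriv v fun y => u y + w y) x =
      dirDeriv v (dirDeriv v u) x + dirDeriv v (dirDeriv v w) x := by
  have h1 : EqOn (dirDeriv v fun y => u y + w y) (fun y => dirDeriv v u y + dirDeriv v w y) Ω :=
    fun y hy => dirDeriv_add (differentiableAt_of_contDiffOn hΩ (hu.of_le (by norm_num)) hy)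
      (differentiableAt_of_contDiffOn hΩ (hw.of_le (by norm_num)) hy) v
  rw [dirDeriv_congr hΩ h1 v hx]
  exact dirDeriv_add (differentiableAt_dirDeriv hΩ hu hx v) (differentiableAt_dirDeriv hΩ hw hx v) v

theorem dirDeriv_sq_const_mul (hΩ : IsOpen Ω) {u : E n → ℝ} (hu : ContDiffOn ℝ 2 u Ω) (c : ℝ)
    (v : E n) {x : E n} (hx : x ∈ Ω) :
    dirDeriv v (dirDeriv v fun y => c * u y) x = c * dirDeriv v (dirDeriv v u) x := by
  have h1 : EqOn (dirDeriv v fun y => c * u y) (fun y => c * dirDeriv v u y) Ω :=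
    fun y hy => dirDeriv_const_mul (differentiableAt_of_contDiffOn hΩ (hu.of_le (by norm_num)) hy)
      c v
  rw [dirDeriv_congr hΩ h1 v hx]
  exact dirDeriv_const_mul (differentiableAt_dirDeriv hΩ hu hx v) c v

theorem dirDeriv_sq_sum {ι : Type*} (hΩ : IsOpen Ω) {s : Finset ι} {u : ι → E n → ℝ}
    (hu : ∀ i ∈ s, ContDiffOn ℝ 2 (u i) Ω) (v : E n) {x : E n} (hx : x ∈ Ω) :
    dirDeriv v (dirDeriv v fun y => ∑ i ∈ s, u i y) x =
      ∑ i ∈ s, dirDeriv v (dirDeriv v (u i)) x := by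
  have h1 : EqOn (dirDeriv v fun y => ∑ i ∈ s, u i y) (fun y => ∑ i ∈ s, dirDeriv v (u i) y) Ω :=
    fun y hy => dirDeriv_sum (fun i hi =>
      differentiableAt_of_contDiffOn hΩ ((hu i hi).of_le (by norm_num)) hy) v
  rw [dirDeriv_congr hΩ h1 v hx]
  exact dirDeriv_sum (fun i hi => differentiableAt_dirDeriv hΩ (hu i hi) hx v) v

theorem dirDeriv_sq_norm_sq (v x : E n) :
    dirDeriv v (dirDeriv v fun y => ‖y‖ ^ 2) x = 2 * ‖v‖ ^ 2 := by
  have h1 : (dirDeriv v fun y : E n => ‖y‖ ^ 2) = fun y => 2 * inner ℝ v y := by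
    ext y
    simp [dirDeriv, fderiv_norm_sq_apply, real_inner_comm]
  have h0 : HasFDerivAt (fun y : E n => inner ℝ v y) (innerSL ℝ v) x := (innerSL ℝ v).hasFDerivAt
  rw [h1, dirDeriv_const_mul h0.differentiableAt]
  have h2 : dirDeriv v (fun y : E n => inner ℝ v y) x = inner ℝ v v := by
    simp [dirDeriv, h0.fderiv]
  rw [h2, real_inner_self_eq_norm_sq]

/-- The second derivative along a line is the iterated directional derivative. -/
theorem deriv_deriv_comp_line {F : E n → ℝ} {x : E n} (hF : ContDiffAt ℝ 2 F x) (e : E n) :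
    deriv (deriv fun t : ℝ => F (x + t • e)) 0 = dirDeriv e (dirDeriv e F) x := by
  have hline : ∀ t : ℝ, HasDerivAt (fun t : ℝ => x + t • e) e t := fun t => by
    simpa using ((hasDerivAt_id t).smul_const e).const_add x
  have hcont : ContinuousAt (fun t : ℝ => x + t • e) 0 := (hline 0).continuousAt
  have hx0 : x + (0 : ℝ) • e = x := by simp
  have hev : ∀ᶠ y in 𝓝 x, DifferentiableAt ℝ F y := by
    filter_upwards [hF.eventually (by simp)] with y hy using hy.differentiableAt (by norm_num)
  have hev' : ∀ᶠ t in 𝓝 (0 : ℝ), DifferentiableAt ℝ F (x + t • e) :=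
    hcont.eventually (by simpa only [hx0] using hev)
  have h1 : deriv (fun t : ℝ => F (x + t • e)) =ᶠ[𝓝 0] fun t => dirDeriv e F (x + t • e) := by
    filter_upwards [hev'] with t ht using (ht.hasFDerivAt.comp_hasDerivAt t (hline t)).deriv
  rw [h1.deriv_eq]
  have hd : DifferentiableAt ℝ (dirDeriv e F) (x + (0 : ℝ) • e) := by
    rw [hx0]
    exact ((hF.fderiv_right (m := 1) (by norm_num)).clm_apply contDiffAt_const).differentiableAt
      (by norm_num)
  have := (hd.hasFDerivAt.comp_hasDerivAt (0 : ℝ) (hline 0)).deriv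
  rw [hx0] at this
  exact this

/-- The second derivative test: necessary condition at a local maximum. -/
theorem dirDeriv_sq_nonpos_of_isLocalMax {F : E n → ℝ} {x : E n} (hF : ContDiffAt ℝ 2 F x)
    (hmax : IsLocalMax F x) (e : E n) : dirDeriv e (dirDeriv e F) x ≤ 0 := by
  by_contra! hpos
  have h2 := deriv_deriv_comp_line hF e
  set k : ℝ → ℝ := fun t => F (x + t • e) with hk
  have hx0 : x + (0 : ℝ) • e = x := by simp
  have hcont : ContinuousAt (fun t : ℝ => x + t • e) 0 := by fun_prop
  have hm : ∀ᶠ y in 𝓝 x, F y ≤ F x := hmax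
  have hkmax : IsLocalMax k 0 := by
    have : ∀ᶠ t in 𝓝 (0 : ℝ), F (x + t • e) ≤ F x := hcont.eventually (p := fun y => F y ≤ F x) (by simpa only [hx0] using hm)
    filter_upwards [this] with t ht
    simpa [hk] using ht
  have hkc : ContinuousAt k 0 :=
    ContinuousAt.comp (f := fun t : ℝ => x + t • e) (by rw [hx0]; exact hF.continuousAt) hcont
  -- A positive second derivative makes the maximum also a minimum, so `k` is locally constant and
  -- its second derivative vanishes.
  have hkmin : IsLocalMin k 0 :=
    isLocalMin_of_deriv_deriv_pos (by rw [h2]; exact hpos) hkmax.deriv_eq_zero hkc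
  have hconst : k =ᶠ[𝓝 0] fun _ => k 0 := by
    filter_upwards [hkmax, hkmin] with t h1 h2 using le_antisymm h1 h2
  have : deriv (deriv k) 0 = 0 := by
    rw [hconst.deriv.deriv_eq]
    simp
  rw [h2] at this
  exact hpos.ne' this

theorem dirDeriv_sq_nonneg_of_isLocalMin {F : E n → ℝ} {x : E n} (hF : ContDiffAt ℝ 2 F x)
    (hmin : IsLocalMin F x) (e : E n) : 0 ≤ dirDeriv e (dirDeriv e F) x := by
  have h := dirDeriv_sq_nonpos_of_isLocalMax hF.neg hmin.neg e
  have h1 : ∀ G : E n → ℝ, dirDeriv e (-G) = -dirDeriv e G := fun G => by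
    ext y
    simp [dirDeriv, fderiv_neg]
  have h2 : dirDeriv e (dirDeriv e (fun y => -F y)) x = -dirDeriv e (dirDeriv e F) x := by
    rw [show (fun y => -F y) = -F from rfl, h1, h1]
    rfl
  have h3 : dirDeriv e (dirDeriv e (fun y => -F y)) x ≤ 0 := h
  linarith

end DirDeriv

/-! ### The Hessian -/

section Hessian

variable {n : ℕ} {Ω : Set (E n)}

theorem hess_apply {u : E n → ℝ} {x : E n} (hu : ContDiffAt ℝ 2 u x) (i j : Fin n) :
    hess u x i j = dirDeriv (EuclideanSpace.single i 1) (dirDeriv (EuclideanSpace.single j 1) u) x := by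
  rw [dirDeriv_dirDeriv_eq hu]
  simp [hess, iteratedFDeriv_two_apply]

theorem sum_single_eq (v : E n) : v = ∑ i, v i • EuclideanSpace.single i (1 : ℝ) := by
  have := (EuclideanSpace.basisFun (Fin n) ℝ).sum_repr v
  simpa using this.symm

/-- Continuous bilinear forms are quadratic forms of their matrices. -/
theorem quadForm_of_iteratedFDeriv (g : (E n) [×2]→L[ℝ] ℝ) (v : E n) :
    quadForm (Matrix.of fun i j => g ![EuclideanSpace.single i (1 : ℝ),
      EuclideanSpace.single j (1 : ℝ)]) v = g ![v, v] := by
  have h0 : ∀ y z w : E n, Function.update ![y, w] 0 z = ![z, w] := fun y z w => by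
    ext i
    fin_cases i <;> rfl
  have h1 : ∀ y z w : E n, Function.update ![z, y] 1 w = ![z, w] := fun y z w => by
    ext i
    fin_cases i <;> rfl
  have hl : ∀ w, IsLinearMap ℝ fun z => g ![z, w] := fun w =>
    ⟨fun a b => by simpa only [h0] using g.map_update_add ![0, w] 0 a b,
      fun c a => by simpa only [h0] using g.map_update_smul ![0, w] 0 c a⟩
  have hr : ∀ z, IsLinearMap ℝ fun w => g ![z, w] := fun z =>
    ⟨fun a b => by simpa only [h1] using g.map_update_add ![z, 0] 1 a b,
      fun c a => by simpa only [h1] using g.map_update_smul ![z, 0] 1 c a⟩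
  rw [quadForm_eq_sum]
  have e1 : g ![v, v] = ∑ i, v i * g ![EuclideanSpace.single i (1 : ℝ), v] := by
    conv_lhs => rw [show g ![v, v] = (hl v).mk' _ v from rfl, sum_single_eq v]
    rw [map_sum]
    simp only [map_smul, IsLinearMap.mk'_apply, smul_eq_mul]
    rw [← sum_single_eq v]
  have e2 : ∀ z, g ![z, v] = ∑ j, v j * g ![z, EuclideanSpace.single j (1 : ℝ)] := fun z => by
    conv_lhs => rw [show g ![z, v] = (hr z).mk' _ v from rfl, sum_single_eq v]
    rw [map_sum]
    simp only [map_smul, IsLinearMap.mk'_apply, smul_eq_mul]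
  rw [e1]
  refine Finset.sum_congr rfl fun i _ => ?_
  rw [e2, Finset.mul_sum]
  exact Finset.sum_congr rfl fun j _ => by simp [mul_assoc]

theorem quadForm_hess {u : E n → ℝ} {x : E n} (hu : ContDiffAt ℝ 2 u x) (v : E n) :
    quadForm (hess u x) v = dirDeriv v (dirDeriv v u) x := by
  rw [hess, quadForm_of_iteratedFDeriv, dirDeriv_dirDeriv_eq hu]
  simp [iteratedFDeriv_two_apply]

theorem isHermitian_hess (hΩ : IsOpen Ω) {u : E n → ℝ} (hu : ContDiffOn ℝ 2 u Ω) {x : E n}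
    (hx : x ∈ Ω) : (hess u x).IsHermitian := by
  have hc := hu.contDiffAt (hΩ.mem_nhds hx)
  refine Matrix.IsHermitian.ext fun i j => ?_
  rw [hess_apply hc, hess_apply hc]
  exact dirDeriv_comm hΩ hu _ _ hx

theorem isHermitian_hessGamma (hΩ : IsOpen Ω) {u : E n → ℝ} (hu : ContDiffOn ℝ 2 u Ω) (γ : ℝ)
    {x : E n} (hx : x ∈ Ω) : (hessGamma γ u x).IsHermitian := by
  refine (isHermitian_hess hΩ hu hx).add ?_
  refine Matrix.IsHermitian.ext fun i j => ?_
  simp [Matrix.one_apply, eq_comm]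

theorem quadForm_hessGamma {u : E n → ℝ} {x : E n} (γ : ℝ) {v : E n} (hv : ‖v‖ = 1) :
    quadForm (hessGamma γ u x) v = quadForm (hess u x) v + γ * (hess u x).trace := by
  have h1 : v.ofLp ⬝ᵥ v.ofLp = 1 := by
    have := real_inner_self_eq_norm_sq v
    rw [EuclideanSpace.inner_eq_star_dotProduct, hv] at this
    simpa using this
  simp [quadForm, hessGamma, Matrix.add_mulVec, dotProduct_add, Matrix.smul_mulVec, h1]

theorem trace_hess {u : E n → ℝ} {x : E n} (hu : ContDiffAt ℝ 2 u x) : (hess u x).trace =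
    ∑ j, dirDeriv (EuclideanSpace.single j 1) (dirDeriv (EuclideanSpace.single j 1) u) x := by
  simp only [Matrix.trace, Matrix.diag_apply, hess_apply hu]

theorem trace_hessGamma (γ : ℝ) (u : E n → ℝ) (x : E n) :
    (hessGamma γ u x).trace = (1 + n * γ) * (hess u x).trace := by
  simp [hessGamma]
  ring

end Hessian

/-! ### The right-hand side -/

section RightHandSide

variable {n : ℕ} {Ω : Set (E n)}

/-- The cutoff function agrees on `[0, ∞)` with a smooth function on the line. -/
theorem IsCutoff.exists_contDiff {ε₀ : ℝ} {η : ℝ → ℝ} (hε₀ : 0 < ε₀) (hη : IsCutoff ε₀ η) :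
    ∃ θ : ℝ → ℝ, ContDiff ℝ ∞ θ ∧ ∀ t, 0 ≤ t → θ t = η t := by
  -- This extension is identically `1` for `t < ε₀/4`, so no regularity is lost at the endpoint `0`.
  refine ⟨fun t => if t ≤ 0 then 1 else η t, ?_, fun t ht => ?_⟩
  · rw [contDiff_iff_contDiffAt]
    intro t
    rcases lt_or_ge t (ε₀ / 4) with h | h
    · refine (contDiffAt_const (c := (1 : ℝ))).congr_of_eventuallyEq ?_
      filter_upwards [Iio_mem_nhds h] with s hs
      split_ifs with h0
      · rfl
      · exact hη.eq_one s ⟨(not_le.1 h0).le, (mem_Iio.1 hs).le⟩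
    · have ht : 0 < t := by linarith
      refine (hη.smooth.contDiffAt (Ici_mem_nhds ht)).congr_of_eventuallyEq ?_
      filter_upwards [Ioi_mem_nhds ht] with s hs
      exact if_neg (not_le.2 hs)
  · change (if t ≤ 0 then 1 else η t) = η t
    split_ifs with h0
    · exact (hη.eq_one t ⟨ht, by linarith⟩).symm
    · rfl

theorem ContDiffUpToBoundary.exists_norm_iteratedFDeriv_le {k : ℕ∞} {u : E n → ℝ}
    (hu : ContDiffUpToBoundary k u Ω) (hb : Bornology.IsBounded Ω) {m : ℕ} (hm : (m : ℕ∞) ≤ k) :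
    ∃ N : ℝ, 0 ≤ N ∧ ∀ x ∈ Ω, ‖iteratedFDeriv ℝ m u x‖ ≤ N := by
  obtain ⟨g, hg, hgu⟩ := hu.2.2 m hm
  obtain ⟨N, hN⟩ := hb.isCompact_closure.exists_bound_of_continuousOn hg
  refine ⟨max N 0, le_max_right _ _, fun x hx => ?_⟩
  rw [hgu hx]
  exact (hN x (subset_closure hx)).trans (le_max_left _ _)

theorem dirDeriv_comp {θ : ℝ → ℝ} {ψ : E n → ℝ} {x : E n} (hθ : DifferentiableAt ℝ θ (ψ x))
    (hψ : DifferentiableAt ℝ ψ x) (e : E n) :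
    dirDeriv e (fun y => θ (ψ y)) x = deriv θ (ψ x) * dirDeriv e ψ x := by
  have := (hθ.hasDerivAt.comp_hasFDerivAt x hψ.hasFDerivAt).fderiv
  simp only [dirDeriv]
  rw [show (fun y => θ (ψ y)) = θ ∘ ψ from rfl, this]
  simp

theorem dirDeriv_sq_comp (hΩ : IsOpen Ω) {θ : ℝ → ℝ} {ψ : E n → ℝ} (hθ : ContDiff ℝ 2 θ)
    (hψ : ContDiffOn ℝ 2 ψ Ω) (e : E n) {x : E n} (hx : x ∈ Ω) :
    dirDeriv e (dirDeriv e (fun y => θ (ψ y))) x =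
      deriv (deriv θ) (ψ x) * dirDeriv e ψ x ^ 2 +
        deriv θ (ψ x) * dirDeriv e (dirDeriv e ψ) x := by
  have hψd : ∀ y ∈ Ω, DifferentiableAt ℝ ψ y := fun y hy =>
    differentiableAt_of_contDiffOn hΩ (hψ.of_le (by norm_num)) hy
  have hθ1 : ContDiff ℝ 1 (deriv θ) := ((contDiff_succ_iff_deriv (n := 1)).1 hθ).2.2
  have hθ1d : Differentiable ℝ (deriv θ) := hθ1.differentiable (by norm_num)
  have h1 : EqOn (dirDeriv e (fun y => θ (ψ y))) (fun y => deriv θ (ψ y) * dirDeriv e ψ y) Ω :=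
    fun y hy => dirDeriv_comp (hθ.differentiable (by norm_num) _) (hψd y hy) e
  rw [dirDeriv_congr hΩ h1 e hx]
  have hd : DifferentiableAt ℝ (fun y => deriv θ (ψ y)) x :=
    (hθ1d _).comp x (hψd x hx)
  have h2 := dirDeriv_comp (hθ1d (ψ x)) (hψd x hx) e
  have h3 : dirDeriv e (fun y => deriv θ (ψ y) * dirDeriv e ψ y) x =
      deriv θ (ψ x) * dirDeriv e (dirDeriv e ψ) x +
        dirDeriv e ψ x * dirDeriv e (fun y => deriv θ (ψ y)) x := by
    rw [dirDeriv, fderiv_fun_mul hd (differentiableAt_dirDeriv hΩ hψ hx e)]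
    rfl
  rw [h3, h2]
  ring

/-- The second derivatives of `ψ + ε η(ψ)` are bounded from below uniformly in `ε`. -/
theorem exists_rhs_bound (hΩ : IsOpen Ω) (hb : Bornology.IsBounded Ω) {ψ : E n → ℝ}
    (hψ : ContDiffUpToBoundary ⊤ ψ Ω) (hψ_nonneg : ∀ x ∈ Ω, 0 ≤ ψ x) {ε₀ : ℝ} (hε₀ : 0 < ε₀)
    {η : ℝ → ℝ} (hη : IsCutoff ε₀ η) :
    ∃ N : ℝ, 0 ≤ N ∧ ∀ ε : ℝ, 0 < ε → ε ≤ ε₀ / 2 →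
      ContDiffOn ℝ 2 (fun x => ψ x + ε * η (ψ x)) Ω ∧
      ∀ x ∈ Ω, ∀ e : E n, ‖e‖ = 1 →
        -N ≤ dirDeriv e (dirDeriv e fun x => ψ x + ε * η (ψ x)) x := by
  obtain ⟨θ, hθ, hθη⟩ := hη.exists_contDiff hε₀
  have hθ2 : ContDiff ℝ 2 θ := contDiff_infty.1 hθ 2
  have hψ2 : ContDiffOn ℝ 2 ψ Ω := contDiffOn_infty.1 hψ.2.1 2
  obtain ⟨N₀, hN₀, h0⟩ := hψ.exists_norm_iteratedFDeriv_le hb (m := 0) le_top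
  obtain ⟨N₁, hN₁, h1⟩ := hψ.exists_norm_iteratedFDeriv_le hb (m := 1) le_top
  obtain ⟨N₂, hN₂, h2⟩ := hψ.exists_norm_iteratedFDeriv_le hb (m := 2) le_top
  have hθ1 : ContDiff ℝ 1 (deriv θ) := ((contDiff_succ_iff_deriv (n := 1)).1 hθ2).2.2
  have hθ1' : Continuous (deriv (deriv θ)) := hθ1.continuous_deriv (by norm_num)
  obtain ⟨T₁, hT₁⟩ := (isCompact_Icc (a := (0 : ℝ)) (b := N₀)).exists_bound_of_continuousOn
    hθ1.continuous.continuousOn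
  obtain ⟨T₂, hT₂⟩ := (isCompact_Icc (a := (0 : ℝ)) (b := N₀)).exists_bound_of_continuousOn
    hθ1'.continuousOn
  have hT₁0 : 0 ≤ T₁ := (norm_nonneg _).trans (hT₁ 0 ⟨le_rfl, hN₀⟩)
  have hT₂0 : 0 ≤ T₂ := (norm_nonneg _).trans (hT₂ 0 ⟨le_rfl, hN₀⟩)
  -- Chain rule: `Ψ_ee = ψ_ee + ε (θ'' ψ_e² + θ' ψ_ee)`, with `ε ≤ ε₀/2`.
  refine ⟨N₂ + ε₀ / 2 * (T₂ * N₁ ^ 2 + T₁ * N₂), by positivity, fun ε hε hε' => ?_⟩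
  have heq : EqOn (fun x => ψ x + ε * η (ψ x)) (fun x => ψ x + ε * θ (ψ x)) Ω := fun x hx => by
    simp only [hθη _ (hψ_nonneg x hx)]
  have hcomp : ContDiffOn ℝ 2 (fun x => θ (ψ x)) Ω := hθ2.comp_contDiffOn hψ2
  have hcomp' : ContDiffOn ℝ 2 (fun x => ε * θ (ψ x)) Ω := contDiffOn_const.mul hcomp
  refine ⟨(hψ2.add hcomp').congr heq, fun x hx e he => ?_⟩
  rw [dirDeriv_congr hΩ (dirDeriv_congr hΩ heq e) e hx, dirDeriv_sq_add hΩ hψ2 hcomp' e hx,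
    dirDeriv_sq_const_mul hΩ hcomp ε e hx, dirDeriv_sq_comp hΩ hθ2 hψ2 e hx]
  have hmem : ψ x ∈ Icc 0 N₀ := ⟨hψ_nonneg x hx, by
    have := h0 x hx
    rw [norm_iteratedFDeriv_zero] at this
    exact (le_abs_self _).trans this⟩
  have b1 : |dirDeriv e ψ x| ≤ N₁ := by
    have h := (fderiv ℝ ψ x).le_opNorm e
    rw [he, mul_one, ← norm_iteratedFDeriv_one] at h
    exact h.trans (h1 x hx)
  have b2 : |dirDeriv e (dirDeriv e ψ) x| ≤ N₂ := by
    rw [dirDeriv_dirDeriv_eq (hψ2.contDiffAt (hΩ.mem_nhds hx))]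
    have h := (iteratedFDeriv ℝ 2 ψ x).le_opNorm ![e, e]
    rw [iteratedFDeriv_two_apply] at h
    simp only [Fin.prod_univ_two, Matrix.cons_val_zero, Matrix.cons_val_one, he, mul_one] at h
    exact h.trans (h2 x hx)
  have b3 : |deriv (deriv θ) (ψ x) * dirDeriv e ψ x ^ 2 +
      deriv θ (ψ x) * dirDeriv e (dirDeriv e ψ) x| ≤ T₂ * N₁ ^ 2 + T₁ * N₂ := by
    refine (abs_add_le _ _).trans (add_le_add ?_ ?_)
    · rw [abs_mul, abs_pow]
      exact mul_le_mul (hT₂ _ hmem) (pow_le_pow_left₀ (abs_nonneg _) b1 2) (by positivity) hT₂0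
    · rw [abs_mul]
      exact mul_le_mul (hT₁ _ hmem) b2 (abs_nonneg _) hT₁0
  have b4 := neg_le_of_abs_le b3
  have b5 : ε * (T₂ * N₁ ^ 2 + T₁ * N₂) ≤ ε₀ / 2 * (T₂ * N₁ ^ 2 + T₁ * N₂) := by gcongr
  have b6 := mul_le_mul_of_nonneg_left b4 hε.le
  have b7 := neg_le_of_abs_le b2
  linarith

/-- Either `t` is small and `η t = 1`, or `t` itself is positive. This is what makes the
approximating problem nondegenerate. -/
theorem IsCutoff.rhs_pos {ε₀ : ℝ} {η : ℝ → ℝ} (hη : IsCutoff ε₀ η) (hε₀ : 0 < ε₀) {ε t : ℝ}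
    (hε : 0 < ε) (ht : 0 ≤ t) : 0 < t + ε * η t := by
  rcases lt_or_ge t (ε₀ / 4) with h | h
  · rw [hη.eq_one t ⟨ht, h.le⟩]
    linarith
  · have := mul_nonneg hε.le (hη.mem_Icc t ht).1
    linarith

theorem IsCutoff.rhs_le {ε₀ : ℝ} {η : ℝ → ℝ} (hη : IsCutoff ε₀ η) {ε t : ℝ}
    (hε : 0 < ε) (hε' : ε ≤ ε₀ / 2) (ht : 0 ≤ t) : t + ε * η t ≤ max t ε₀ := by
  rcases lt_or_ge t (ε₀ / 2) with h | h
  · have := mul_le_mul_of_nonneg_left (hη.mem_Icc t ht).2 hε.le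
    exact le_max_of_le_right (by linarith)
  · rw [hη.eq_zero t h]
    exact le_max_of_le_left (by linarith)

end RightHandSide

/-! ### Norms of matrices -/

section MatNorm

variable {n : ℕ}

theorem continuous_matNorm : Continuous (matNorm (n := n)) := by
  unfold matNorm
  fun_prop

theorem continuous_quadForm (v : E n) : Continuous fun A => quadForm A v := by
  unfold quadForm
  fun_prop

theorem quadForm_le_matNorm (A : Matrix (Fin n) (Fin n) ℝ) (v : E n) :
    quadForm A v ≤ matNorm A * ‖v‖ ^ 2 := by
  have h1 := Finset.sum_mul_sq_le_sq_mul_sq (Finset.univ : Finset (Fin n × Fin n))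
    (fun p => v p.1 * v p.2) (fun p => A p.1 p.2)
  have h2 : ∑ p : Fin n × Fin n, (v p.1 * v p.2) ^ 2 = (‖v‖ ^ 2) ^ 2 := by
    rw [EuclideanSpace.real_norm_sq_eq, sq (∑ i, _), Finset.sum_mul_sum, Fintype.sum_prod_type]
    simp only [mul_pow]
  have h3 : ∑ p : Fin n × Fin n, A p.1 p.2 ^ 2 = matNorm A ^ 2 := by
    rw [matNorm, Real.sq_sqrt (by positivity), Fintype.sum_prod_type]
  have h4 : ∑ p : Fin n × Fin n, v p.1 * v p.2 * A p.1 p.2 = quadForm A v := by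
    rw [quadForm_eq_sum, Fintype.sum_prod_type]
  rw [h2, h3, h4, ← mul_pow] at h1
  have h5 : 0 ≤ matNorm A := Real.sqrt_nonneg _
  rw [mul_comm]
  exact le_of_sq_le_sq h1 (by positivity)

theorem quadForm_smul (A : Matrix (Fin n) (Fin n) ℝ) (c : ℝ) (v : E n) :
    quadForm A (c • v) = c ^ 2 * quadForm A v := by
  simp [quadForm, Matrix.mulVec_smul]
  ring

theorem quadForm_single_add {A : Matrix (Fin n) (Fin n) ℝ} (hA : A.IsHermitian) (i j : Fin n)
    (s : ℝ) : quadForm A (EuclideanSpace.single i 1 + s • EuclideanSpace.single j 1) =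
      A i i + s ^ 2 * A j j + 2 * s * A i j := by
  have hT : A j i = A i j := by simpa using hA.apply i j
  simp [quadForm, Matrix.mulVec_add, Matrix.mulVec_smul, hT]
  ring

/-- A symmetric matrix with nonnegative trace is controlled by the maximum of its quadratic form on
the unit sphere. -/
theorem matNorm_le {A : Matrix (Fin n) (Fin n) ℝ} (hA : A.IsHermitian) {β : ℝ} (hβ : 0 ≤ β)
    (htr : 0 ≤ A.trace) (hq : ∀ e : E n, ‖e‖ = 1 → quadForm A e ≤ β) :
    matNorm A ≤ n ^ 2 * β := by
  have hq' : ∀ v : E n, quadForm A v ≤ β * ‖v‖ ^ 2 := fun v => by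
    rcases eq_or_ne v 0 with rfl | hv
    · simp [quadForm]
    · have hv' : ‖v‖ ≠ 0 := norm_ne_zero_iff.2 hv
      have h1 := hq (‖v‖⁻¹ • v) (by rw [norm_smul, norm_inv, norm_norm, inv_mul_cancel₀ hv'])
      rw [quadForm_smul, inv_pow, inv_mul_le_iff₀ (by positivity)] at h1
      linarith
  have hdiag : ∀ i, A i i ≤ β := fun i => by
    have := hq' (EuclideanSpace.single i 1 + (0 : ℝ) • EuclideanSpace.single i 1)
    rw [quadForm_single_add hA] at this
    simpa using this
  have hdiag' : ∀ i, -((n - 1) * β) ≤ A i i := fun i => by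
    have h1 : A.trace = A i i + ∑ j ∈ Finset.univ.erase i, A j j :=
      (Finset.add_sum_erase _ _ (Finset.mem_univ i)).symm
    have h2 : ∑ j ∈ Finset.univ.erase i, A j j ≤ ∑ j ∈ Finset.univ.erase i, β :=
      Finset.sum_le_sum fun j _ => hdiag j
    have hn : 1 ≤ n := i.pos
    rw [Finset.sum_const, Finset.card_erase_of_mem (Finset.mem_univ i), Finset.card_univ,
      Fintype.card_fin, nsmul_eq_mul, Nat.cast_sub hn, Nat.cast_one] at h2
    linarith
  have hentry : ∀ i j, |A i j| ≤ n * β := fun i j => by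
    have hn : (1 : ℝ) ≤ n := by exact_mod_cast i.pos
    rcases eq_or_ne i j with rfl | hij
    · rw [abs_le]
      constructor <;> nlinarith [hdiag i, hdiag' i]
    · have hnorm : ∀ s : ℝ, ‖(EuclideanSpace.single i 1 + s • EuclideanSpace.single j 1 : E n)‖ ^ 2
          = 1 + s ^ 2 := fun s => by
        have h0 : inner ℝ (EuclideanSpace.single i 1 : E n)
            (s • EuclideanSpace.single j 1) = 0 := by
          simp [inner_smul_right, EuclideanSpace.inner_single_left, hij]
        rw [norm_add_sq_real, h0, norm_smul]
        simp
      -- Testing with `eᵢ ± eⱼ` gives `±2 Aᵢⱼ ≤ 2β - Aᵢᵢ - Aⱼⱼ ≤ 2nβ`, using the lower diagonal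
      -- bound that comes from the trace.
      have h1 := hq' (EuclideanSpace.single i 1 + (1 : ℝ) • EuclideanSpace.single j 1)
      have h2 := hq' (EuclideanSpace.single i 1 + (-1 : ℝ) • EuclideanSpace.single j 1)
      rw [hnorm, quadForm_single_add hA] at h1 h2
      have := hdiag' i
      have := hdiag' j
      rw [abs_le]
      constructor <;> linarith
  have hsum : ∑ i, ∑ j, A i j ^ 2 ≤ ∑ _i : Fin n, ∑ _j : Fin n, (n * β) ^ 2 :=
    Finset.sum_le_sum fun i _ => Finset.sum_le_sum fun j _ =>
      sq_le_sq' (neg_le_of_abs_le (hentry i j)) (le_of_abs_le (hentry i j))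
  rw [matNorm]
  refine Real.sqrt_le_iff.2 ⟨by positivity, hsum.trans_eq ?_⟩
  simp
  ring

end MatNorm

/-! ### The Hessian up to the boundary -/

section HessExt

variable {n : ℕ} {Ω : Set (E n)}

theorem ContDiffUpToBoundary.continuousOn_hessExt {u : E n → ℝ}
    (hu : ContDiffUpToBoundary 4 u Ω) :
    ContinuousOn (hessExt u Ω) (closure Ω) ∧ EqOn (hessExt u Ω) (hess u) Ω := by
  obtain ⟨g, hg, hgu⟩ := hu.2.2 2 (by norm_num)
  set G : E n → Matrix (Fin n) (Fin n) ℝ := fun x => Matrix.of fun i j =>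
    g x ![EuclideanSpace.single i (1 : ℝ), EuclideanSpace.single j (1 : ℝ)] with hG
  have hGc : ContinuousOn G (closure Ω) := by
    refine continuousOn_pi.2 fun i => continuousOn_pi.2 fun j => ?_
    exact (ContinuousMultilinearMap.apply ℝ (fun _ : Fin 2 => E n) ℝ _).continuous.comp_continuousOn
      hg
  have hGu : EqOn (hess u) G Ω := fun x hx => by
    ext i j
    simp [hess, hG, hgu hx]
  have hext : EqOn (hessExt u Ω) G (closure Ω) := fun x hx => by
    refine extendFrom_eq hx ?_
    refine ((hGc x hx).mono subset_closure).congr' ?_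
    filter_upwards [self_mem_nhdsWithin] with y hy using (hGu hy).symm
  exact ⟨hGc.congr hext, fun x hx => (hext (subset_closure hx)).trans (hGu hx).symm⟩

end HessExt

/-! ### The maximum principle -/

section MaximumPrinciple

variable {n : ℕ} {Ω : Set (E n)} {Γ : Set (Fin n → ℝ)} {f : (Fin n → ℝ) → ℝ}

/-- The concavity of `f ∘ λ` makes `u_ee + A|x|²/2` a strict subsolution of the linearized equation
when `A` is large, so it has no interior local maximum. -/
theorem not_isLocalMax_secondDeriv (hΩ : IsOpen Ω) (hΓ : IsAdmissibleCone Γ)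
    (hf : StructureConditions Γ f) {γ : ℝ} (hγ : 0 < γ) {u Ψ : E n → ℝ}
    (hu : ContDiffOn ℝ 4 u Ω) (hΨ : ContDiffOn ℝ 2 Ψ Ω)
    (hmem : ∀ x ∈ Ω, eig (hessGamma γ u x) ∈ Γ)
    (heq : ∀ x ∈ Ω, f (eig (hessGamma γ u x)) = Ψ x) {x₀ : E n} (hx₀ : x₀ ∈ Ω) {e : E n}
    {N c A : ℝ} (hN : -N ≤ dirDeriv e (dirDeriv e Ψ) x₀) (hA : 0 ≤ A) (hAc : N < A * c)
    (hc : c ≤ ∑ i, fderiv ℝ f (eig (hessGamma γ u x₀)) (Pi.single i 1)) :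
    ¬ IsLocalMax (fun x => dirDeriv e (dirDeriv e u) x + A / 2 * ‖x‖ ^ 2) x₀ := by
  intro hmax
  have hu2 : ContDiffOn ℝ 2 u Ω := hu.of_le (by norm_num)
  have hDu : ∀ v, ContDiffOn ℝ 2 (dirDeriv v (dirDeriv v u)) Ω := fun v =>
    contDiffOn_dirDeriv_dirDeriv hΩ hu v v
  have hnorm : ContDiffOn ℝ 2 (fun x : E n => ‖x‖ ^ 2) Ω := (contDiff_norm_sq ℝ).contDiffOn
  have hAnorm : ContDiffOn ℝ 2 (fun x : E n => A / 2 * ‖x‖ ^ 2) Ω := contDiffOn_const.mul hnorm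
  -- Second derivative test for `u_ee + A|x|²/2` in direction `b`, with the derivatives then
  -- exchanged.
  have hfourth : ∀ b : E n, ‖b‖ = 1 →
      dirDeriv e (dirDeriv e (dirDeriv b (dirDeriv b u))) x₀ ≤ -A := fun b hb => by
    have h := dirDeriv_sq_nonpos_of_isLocalMax
      (((hDu e).add hAnorm).contDiffAt (hΩ.mem_nhds hx₀)) hmax b
    rw [dirDeriv_sq_add hΩ (hDu e) hAnorm b hx₀, dirDeriv_sq_const_mul hΩ hnorm _ b hx₀,
      dirDeriv_sq_norm_sq, hb] at h
    rw [dirDeriv_sq_comm hΩ hu e b hx₀]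
    linarith
  have hH := isHermitian_hessGamma hΩ hu2 γ hx₀
  set b := hH.eigenvectorBasis with hb
  set p : Fin n → ℝ := fun i => fderiv ℝ f (eig (hessGamma γ u x₀)) (Pi.single i 1) with hp
  have hp0 : ∀ i, 0 ≤ p i := fun i => (hf.deriv_pos _ (hmem _ hx₀) i).le
  set s : Fin n → E n := fun j => EuclideanSpace.single j 1 with hs
  set L : E n → ℝ := fun y => ∑ j, dirDeriv (s j) (dirDeriv (s j) u) y with hL
  have hLc : ContDiffOn ℝ 2 L Ω := ContDiffOn.sum fun j _ => hDu _
  have hγL : ContDiffOn ℝ 2 (fun y => γ * L y) Ω := contDiffOn_const.mul hLc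
  set w : Fin n → E n → ℝ := fun i y => dirDeriv (b i) (dirDeriv (b i) u) y + γ * L y with hw
  have hwc : ∀ i, ContDiffOn ℝ 2 (w i) Ω := fun i => (hDu _).add hγL
  have hpw : ∀ i, ContDiffOn ℝ 2 (fun y => p i * w i y) Ω := fun i => contDiffOn_const.mul (hwc i)
  have hP : ContDiffOn ℝ 2 (fun y => ∑ i, p i * w i y) Ω := ContDiffOn.sum fun i _ => hpw i
  have hΨ' : ContDiffOn ℝ 2 (fun y => (-1) * Ψ y) Ω := contDiffOn_const.mul hΨ
  have hquad : ∀ i, ∀ y ∈ Ω, quadForm (hessGamma γ u y) (b i) = w i y := fun i y hy => by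
    have hcd := hu2.contDiffAt (hΩ.mem_nhds hy)
    rw [quadForm_hessGamma γ (b.norm_eq_one i), quadForm_hess hcd, trace_hess hcd]
  -- Basis `b` and weights `p` are frozen at `x₀`. The supergradient inequality says that `∑ pᵢ wᵢ -
  -- Ψ` is minimal at `x₀`; testing this minimum in direction `e` replaces differentiating
  -- eigenvalues twice.
  have hmin : IsLocalMin (fun y => (∑ i, p i * w i y) + (-1) * Ψ y) x₀ := by
    filter_upwards [hΩ.mem_nhds hx₀] with y hy
    have h := hf.eig_le_tangent hΓ hH (isHermitian_hessGamma hΩ hu2 γ hy) (hmem _ hx₀) (hmem _ hy)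
    rw [heq _ hx₀, heq _ hy] at h
    have h1 : ∑ i, (quadForm (hessGamma γ u y) (b i) - quadForm (hessGamma γ u x₀) (b i)) * p i =
        ∑ i, p i * w i y - ∑ i, p i * w i x₀ := by
      rw [← Finset.sum_sub_distrib]
      refine Finset.sum_congr rfl fun i _ => ?_
      rw [hquad i y hy, hquad i x₀ hx₀]
      ring
    have h2 := h.trans_eq (congrArg (Ψ x₀ + ·) h1)
    linarith
  have hsecond := dirDeriv_sq_nonneg_of_isLocalMin
    ((hP.add hΨ').contDiffAt (hΩ.mem_nhds hx₀)) hmin e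
  rw [dirDeriv_sq_add hΩ hP hΨ' e hx₀, dirDeriv_sq_const_mul hΩ hΨ _ e hx₀,
    dirDeriv_sq_sum hΩ (fun i _ => hpw i) e hx₀] at hsecond
  have hLle : dirDeriv e (dirDeriv e L) x₀ ≤ 0 := by
    rw [hL, dirDeriv_sq_sum hΩ (fun j _ => hDu _) e hx₀]
    refine Finset.sum_nonpos fun j _ => (hfourth (s j) (by simp [hs])).trans (by linarith)
  have hsum : ∑ i, dirDeriv e (dirDeriv e fun y => p i * w i y) x₀ ≤ ∑ i, p i * (-A) := by
    refine Finset.sum_le_sum fun i _ => ?_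
    rw [dirDeriv_sq_const_mul hΩ (hwc i) _ e hx₀]
    refine mul_le_mul_of_nonneg_left ?_ (hp0 i)
    rw [hw, dirDeriv_sq_add hΩ (hDu _) hγL e hx₀, dirDeriv_sq_const_mul hΩ hLc _ e hx₀]
    have := hfourth (b i) (b.norm_eq_one i)
    have := mul_nonpos_of_nonneg_of_nonpos hγ.le hLle
    linarith
  rw [← Finset.sum_mul] at hsum
  -- Contradiction: `0 ≤ -A ∑ pᵢ - Ψ_ee ≤ -A c + N < 0`.
  have := mul_le_mul_of_nonneg_left hc hA
  linarith

/-- The eigenvalues of `D²u + γ Δu I` are bounded for `u ∈ C⁴(Ω̄)`. -/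
theorem ContDiffUpToBoundary.exists_eig_le (hΩ : IsOpen Ω) (hb : Bornology.IsBounded Ω)
    {u : E n → ℝ} (hu : ContDiffUpToBoundary 4 u Ω) (γ : ℝ) :
    ∃ R : ℝ, ∀ x ∈ Ω, ∀ i, eig (hessGamma γ u x) i ≤ R := by
  obtain ⟨hc, he⟩ := hu.continuousOn_hessExt
  have hu2 : ContDiffOn ℝ 2 u Ω := hu.2.1.of_le (by norm_num)
  set W : E n → Matrix (Fin n) (Fin n) ℝ := fun x => hessExt u Ω x +
    (γ * (hessExt u Ω x).trace) • (1 : Matrix (Fin n) (Fin n) ℝ) with hW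
  have hcW : ContinuousOn (fun x => matNorm (W x)) (closure Ω) := by
    refine continuous_matNorm.comp_continuousOn ?_
    have : Continuous fun A : Matrix (Fin n) (Fin n) ℝ =>
        A + (γ * A.trace) • (1 : Matrix (Fin n) (Fin n) ℝ) := by fun_prop
    exact this.comp_continuousOn hc
  obtain ⟨R, hR⟩ := hb.isCompact_closure.exists_bound_of_continuousOn hcW
  refine ⟨R, fun x hx i => ?_⟩
  have hH := isHermitian_hessGamma hΩ hu2 γ hx
  rw [eig_eq_quadForm hH]
  refine (quadForm_le_matNorm _ _).trans ?_
  rw [OrthonormalBasis.norm_eq_one, one_pow, mul_one]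
  have h := (le_abs_self _).trans (hR x (subset_closure hx))
  simp only [hW, he hx] at h
  exact h

/-- If the problem has a solution, the right-hand sides stay away from `sup f`, uniformly in `ε`. -/
theorem exists_gap (hn : 0 < n) (hΩ : IsOpen Ω) (hb : Bornology.IsBounded Ω)
    (hΓ : IsAdmissibleCone Γ) (hf : StructureConditions Γ f) {ψ φ : E n → ℝ}
    (hψ_nonneg : ∀ x ∈ Ω, 0 ≤ ψ x) {ε₀ : ℝ} (hε₀ : 0 < ε₀) (hε₀_f : ∃ μ ∈ Γ, ε₀ ≤ f μ)
    {η : ℝ → ℝ} (hη : IsCutoff ε₀ η) {γ ε : ℝ} (hε : 0 < ε) {u : E n → ℝ}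
    (hu : IsApproxSolution Ω Γ f ψ φ η γ ε u) :
    ∃ a b : ℝ, 0 < b ∧ f (fun _ => a) < f (fun _ => b) ∧
      ∀ ε' : ℝ, 0 < ε' → ε' ≤ ε₀ / 2 → ∀ x ∈ Ω, ψ x + ε' * η (ψ x) ≤ f (fun _ => a) := by
  obtain ⟨μ, hμ, hμf⟩ := hε₀_f
  obtain ⟨R, hR⟩ := hu.regular.exists_eig_le hΩ hb γ
  have : Nonempty (Fin n) := ⟨⟨0, hn⟩⟩
  obtain ⟨S, hS⟩ := (finite_range μ).bddAbove
  -- `R` bounds the eigenvalues of the given solution, so `ψ ≤ Ψ ≤ f(a,…,a)`; `S` bounds the entries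
  -- of `μ`, so `ε₀ ≤ f(a,…,a)`; `1` makes `a` positive.
  set a := max (max R S) 1
  have ha : 0 < a := zero_lt_one.trans_le (le_max_right _ _)
  refine ⟨a, a + 1, by linarith, hf.const_lt_const hΓ hn ha (by linarith),
    fun ε' hε' hε'' x hx => (hη.rhs_le hε' hε'' (hψ_nonneg x hx)).trans (max_le ?_ ?_)⟩
  · have hpos := hη.rhs_pos hε₀ hε (hψ_nonneg x hx)
    have heq := hu.equation x hx
    have hmem := hf.mem_of_pos hΓ (hu.admissible x hx) (by rw [heq]; exact hpos)
    have h1 : f (eig (hessGamma γ u x)) ≤ f (fun _ => a) := hf.mono hΓ hmem fun i =>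
      (hR x hx i).trans ((le_max_left _ _).trans (le_max_left _ _))
    have h2 := mul_nonneg hε.le (hη.mem_Icc _ (hψ_nonneg x hx)).1
    linarith
  · exact hμf.trans (hf.mono hΓ hμ fun i =>
      (hS ⟨i, rfl⟩).trans ((le_max_right R S).trans (le_max_left _ _)))

/-- The bound for the second derivatives in terms of their boundary values. -/
theorem matNorm_hessExt_le (hn : 0 < n) (hΩ : IsOpen Ω) (hne : Ω.Nonempty) {R : ℝ}
    (hR : ∀ x ∈ closure Ω, ‖x‖ ≤ R) (hb : Bornology.IsBounded Ω)
    (hΓ : IsAdmissibleCone Γ) (hf : StructureConditions Γ f) {γ : ℝ} (hγ : 0 < γ) {u Ψ : E n → ℝ}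
    (hu : ContDiffUpToBoundary 4 u Ω) (hΨ : ContDiffOn ℝ 2 Ψ Ω)
    (hmem : ∀ x ∈ Ω, eig (hessGamma γ u x) ∈ Γ)
    (heq : ∀ x ∈ Ω, f (eig (hessGamma γ u x)) = Ψ x) {N c A B : ℝ}
    (hN : ∀ x ∈ Ω, ∀ e : E n, ‖e‖ = 1 → -N ≤ dirDeriv e (dirDeriv e Ψ) x) (hA : 0 ≤ A)
    (hAc : N < A * c)
    (hc : ∀ x ∈ Ω, c ≤ ∑ i, fderiv ℝ f (eig (hessGamma γ u x)) (Pi.single i 1))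
    (hB0 : 0 ≤ B) (hB : ∀ x ∈ frontier Ω, matNorm (hessExt u Ω x) ≤ B) :
    ∀ x ∈ closure Ω, matNorm (hessExt u Ω x) ≤ n ^ 2 * (B + A / 2 * R ^ 2) := by
  obtain ⟨hcont, hext⟩ := hu.continuousOn_hessExt
  have hu4 : ContDiffOn ℝ 4 u Ω := hu.2.1
  have hu2 : ContDiffOn ℝ 2 u Ω := hu4.of_le (by norm_num)
  have hquad : ∀ e : E n, ‖e‖ = 1 → ∀ x ∈ closure Ω,
      quadForm (hessExt u Ω x) e ≤ B + A / 2 * R ^ 2 := fun e he x hx => by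
    set V : E n → ℝ := fun x => quadForm (hessExt u Ω x) e + A / 2 * ‖x‖ ^ 2 with hV
    have hVc : ContinuousOn V (closure Ω) :=
      ((continuous_quadForm e).comp_continuousOn hcont).add (by fun_prop)
    obtain ⟨y, hy, hmax⟩ := hb.isCompact_closure.exists_isMaxOn hne.closure hVc
    have hyΩ : y ∉ Ω := fun hyΩ => by
      refine not_isLocalMax_secondDeriv hΩ hΓ hf hγ hu4 hΨ hmem heq hyΩ (hN y hyΩ e he) hA hAc
        (hc y hyΩ) ?_
      have hVeq : EqOn V (fun x => dirDeriv e (dirDeriv e u) x + A / 2 * ‖x‖ ^ 2) Ω :=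
        fun z hz => by
          simp only [hV, hext hz, quadForm_hess (hu2.contDiffAt (hΩ.mem_nhds hz))]
      filter_upwards [hΩ.mem_nhds hyΩ] with z hz
      exact (hVeq hz).symm.trans_le ((hmax (subset_closure hz)).trans_eq (hVeq hyΩ))
    have hyF : y ∈ frontier Ω := ⟨hy, by rwa [hΩ.interior_eq]⟩
    have h1 : V x ≤ V y := hmax hx
    have h2 := quadForm_le_matNorm (hessExt u Ω y) e
    rw [he, one_pow, mul_one] at h2
    have h3 := hB y hyF
    have h4 : A / 2 * ‖y‖ ^ 2 ≤ A / 2 * R ^ 2 := by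
      have := hR y hy
      gcongr
    have h5 : 0 ≤ A / 2 * ‖x‖ ^ 2 := by positivity
    simp only [hV] at h1
    linarith
  have hΩbound : ∀ x ∈ Ω, matNorm (hessExt u Ω x) ≤ n ^ 2 * (B + A / 2 * R ^ 2) := fun x hx => by
    refine matNorm_le ?_ (by positivity) ?_ fun e he => hquad e he x (subset_closure hx)
    · rw [hext hx]
      exact isHermitian_hess hΩ hu2 hx
    · have h1 := hf.sum_pos hΓ hn (hmem x hx)
      rw [sum_eig (isHermitian_hessGamma hΩ hu2 γ hx), trace_hessGamma] at h1
      rw [hext hx]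
      exact (pos_of_mul_pos_right h1 (by positivity)).le
  -- Symmetry and the sign of the trace were used only inside `Ω`; continuity carries the bound to
  -- the closure.
  exact le_on_closure hΩbound (continuous_matNorm.comp_continuousOn hcont) continuousOn_const

end MaximumPrinciple

end HessianDirichlet

end

/-- The constant `C` is chosen before `γ`, `ε` and `u`: it depends on `γ` and `u` only through the
upper bounds `K` for `γ⁻¹` and `M` for `|u|_{C¹(Ω̄)}`, and it does not depend on `ε`. -/
theorem theorem4p2 (n : ℕ) (hn : 2 ≤ n)
    (Ω : Set (HessianDirichlet.E n)) (hΩ : HessianDirichlet.IsSmoothBoundedDomain Ω)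
    (Γ : Set (Fin n → ℝ)) (hΓ : HessianDirichlet.IsAdmissibleCone Γ)
    (f : (Fin n → ℝ) → ℝ) (hf : HessianDirichlet.StructureConditions Γ f)
    (ψ : HessianDirichlet.E n → ℝ) (hψ : HessianDirichlet.ContDiffUpToBoundary ⊤ ψ Ω)
    (hψ_nonneg : ∀ x ∈ Ω, 0 ≤ ψ x)
    (φ : HessianDirichlet.E n → ℝ) (hφ : HessianDirichlet.SmoothOnBoundary φ Ω)
    (ε₀ : ℝ) (hε₀ : 0 < ε₀) (hε₀_f : ∃ μ ∈ Γ, ε₀ ≤ f μ)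
    (η : ℝ → ℝ) (hη : HessianDirichlet.IsCutoff ε₀ η)
    (K M : ℝ) :
    ∃ C : ℝ, 0 < C ∧
      ∀ γ : ℝ, 0 < γ → γ⁻¹ ≤ K →
      ∀ ε : ℝ, 0 < ε → ε ≤ ε₀ / 2 →
      ∀ u : HessianDirichlet.E n → ℝ,
        HessianDirichlet.IsApproxSolution Ω Γ f ψ φ η γ ε u →
        HessianDirichlet.c1Norm u Ω ≤ M →
        BddAbove ((fun x => HessianDirichlet.matNorm (HessianDirichlet.hessExt u Ω x)) ''
          closure Ω) ∧
        sSup ((fun x => HessianDirichlet.matNorm (HessianDirichlet.hessExt u Ω x)) '' closure Ω) ≤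
          C * (1 + sSup ((fun x => HessianDirichlet.matNorm (HessianDirichlet.hessExt u Ω x)) ''
            frontier Ω)) := by
  open HessianDirichlet in
  have hn0 : 0 < n := by omega
  have hop := hΩ.isOpen
  -- If no solution exists for any parameters, any `C` works. Otherwise a single solution supplies
  -- `a` and `b`, and these serve all other `γ`, `ε` and `u`, since they only compare `ψ` and `ε₀`
  -- with values of `f`.
  by_cases hex : ∃ γ ε : ℝ, ∃ u : E n → ℝ, 0 < ε ∧ IsApproxSolution Ω Γ f ψ φ η γ ε u
  swap
  · exact ⟨1, one_pos, fun γ _ _ ε hε _ u hu _ => (hex ⟨γ, ε, u, hε, hu⟩).elim⟩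
  obtain ⟨γ₁, ε₁, u₁, hε₁, hu₁⟩ := hex
  obtain ⟨a, b, hb, hab, hle⟩ := exists_gap hn0 hop hΩ.isBounded hΓ hf hψ_nonneg hε₀ hε₀_f hη hε₁ hu₁
  obtain ⟨N, hN0, hN⟩ := exists_rhs_bound hop hΩ.isBounded hψ hψ_nonneg hε₀ hη
  obtain ⟨R, hR⟩ := hΩ.isBounded.isCompact_closure.isBounded.exists_norm_le
  set c := (f (fun _ => b) - f (fun _ => a)) / b with hc
  have hc0 : 0 < c := div_pos (sub_pos.2 hab) hb
  set A := (N + 1) / c with hA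
  have hA0 : 0 ≤ A := by positivity
  have hAc : N < A * c := by
    rw [hA, div_mul_cancel₀ _ hc0.ne']
    linarith
  -- Chosen so that `B + A R²/2 ≤ (1 + A R²/2)(1 + B)` for `B ≥ 0`.
  refine ⟨n ^ 2 * (1 + A / 2 * R ^ 2), by positivity, fun γ hγ _ ε hε hε' u hu _ => ?_⟩
  obtain ⟨hΨ, hΨN⟩ := hN ε hε hε'
  have hmem : ∀ x ∈ Ω, eig (hessGamma γ u x) ∈ Γ := fun x hx =>
    hf.mem_of_pos hΓ (hu.admissible x hx) (by
      rw [hu.equation x hx]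
      exact hη.rhs_pos hε₀ hε (hψ_nonneg x hx))
  have hcle : ∀ x ∈ Ω, c ≤ ∑ i, fderiv ℝ f (eig (hessGamma γ u x)) (Pi.single i 1) :=
    fun x hx => by
      rw [hc, div_le_iff₀' hb]
      have h1 := hf.le_mul_sum_deriv hΓ (hmem x hx) hb
      have h2 := hle ε hε hε' x hx
      rw [← hu.equation x hx] at h2
      linarith
  have hcont : ContinuousOn (fun x => matNorm (hessExt u Ω x)) (closure Ω) :=
    continuous_matNorm.comp_continuousOn hu.regular.continuousOn_hessExt.1
  have hbdd := hΩ.isBounded.isCompact_closure.bddAbove_image hcont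
  refine ⟨hbdd, ?_⟩
  set B := sSup ((fun x => matNorm (hessExt u Ω x)) '' frontier Ω) with hB
  have hB0 : 0 ≤ B := Real.sSup_nonneg (by
    rintro _ ⟨x, -, rfl⟩
    exact Real.sqrt_nonneg _)
  have hBle : ∀ x ∈ frontier Ω, matNorm (hessExt u Ω x) ≤ B := fun x hx =>
    le_csSup (hbdd.mono (image_mono frontier_subset_closure)) ⟨x, hx, rfl⟩
  refine csSup_le (hΩ.isConnected.nonempty.closure.image _) ?_
  rintro _ ⟨x, hx, rfl⟩
  refine (matNorm_hessExt_le hn0 hop hΩ.isConnected.nonempty hR hΩ.isBounded hΓ hf hγ hu.regular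
    hΨ hmem hu.equation hΨN hA0 hAc hcle hB0 hBle x hx).trans ?_
  rw [mul_assoc]
  refine mul_le_mul_of_nonneg_left ?_ (by positivity)
  have : 0 ≤ A / 2 * R ^ 2 * B := by positivity
  linarith
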